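/- There are $m$ owners and $n$ items. Owner $j$ owns a set of items $\mathcal I^j\subseteq[n]$. Item $i$ has a ground-truth score $R_i\in\mathbb R$ and a raw review score $y_i=R_i+z_i$, where the noise vector $z=(z_1,\dots,z_n)$ is exchangeable: $(z_{\rho(1)},\dots,z_{\rho(n)})$ has the same distribution as $z$ for every permutation $\rho$ of $[n]$. Owner $j$ has the utility $\mathrm U^j(\hat R)=\sum_{i\in\mathcal I^j}U^j(\hat R_i)$ of adjusted scores $\hat R\in\mathbb R^n$, where $U^j:\mathbb R\to\mathbb R$ is convex and non-decreasing. Owner $j$ has a credential $\alpha^j\in[0,1]$. Let $\mathfrak S=\{\mathcal S_1,\dots,\mathcal S_K\}$ be any partition of the item set $[n]$ into non-empty blocks, and let $\mathcal T_k=\{j:\mathcal S_k\subseteq\mathcal I^j\}$ be the set of owners who own the entire block $\mathcal S_k$. Whenever $|\mathcal S_k|\ge 2$ and $\mathcal T_k\ne\varnothing$, assume $\sum_{j\in\mathcal T_k}\alpha^j>0$. The partition-based isotonic mechanism treats each block $\mathcal S_k$ as follows. - If $|\mathcal S_k|\ge2$ and $\mathcal T_k\neq\varnothing$, every owner $j\in\mathcal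 T_k$ reports a ranking $\pi^j_k$ of the items of $\mathcal S_k$ (best first), and the adjusted scores of the items in $\mathcal S_k$ are $$\hat R[\mathcal S_k]=\frac{\sum_{j\in\mathcal T_k}\alpha^j\,\hat R(\pi^j_k;y)}{\sum_{j\in\mathcal T_k}\alpha^j},\qquad \hat R(\pi;y)=\operatorname*{argmin}\Big\{\sum_{i\in\mathcal S_k}(y_i-r_i)^2:\ r\in\mathbb R^{\mathcal S_k},\ r_{\pi(1)}\ge r_{\pi(2)}\ge\dots\ge r_{\pi(|\mathcal S_k|)}\Big\}.$$ - If $|\mathcal S_k|=1$ or $\mathcal T_k=\varnothing$, no ranking is elicited and $\hat R_i=y_i$ for $i\in\mathcal S_k$. A ranking $\pi$ of $\mathcal S_k$ is true if $R_{\pi(1)}\ge\dots\ge R_{\pi(|\mathcal S_k|)}$. If ground-truth scores tie inside a block, ties are broken in the same way for all its owners, i.e. the true ranking of a block is one and the same for all owners in $\mathcal T_k$. Then truthful reporting is a Bayes–Nash equilibrium of this mechanism. Explicitly, suppose that all owners report the true ranking of every block from which they are elicited. Then for every owner $j$, and for every alternative report of $j$, consisting of an arbitrary ranking of each block elicited from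 $j$, $$\mathbb E\big[\mathrm U^j(\hat R)\big]\ \ge\ \mathbb E\big[\mathrm U^j(\tilde R)\big],$$ where $\hat R$ is the mechanism's output under the truthful reports and $\tilde R$ its output when $j$ alone switches to the alternative report. The expectations are over the noise $z$ and are assumed to exist (be finite). -/

import Mathlib

open MeasureTheory

/-- `r` solves the isotonic regression of the scores `y` under the ranking `π`: it minimises the
squared Euclidean distance to `y` among all vectors `r'` with
`r' (π 0) ≥ r' (π 1) ≥ ⋯ ≥ r' (π (k - 1))`. -/
def IsIsotonicFit {ι : Type*} [Fintype ι] {k : ℕ} (π : Fin k ≃ ι) (y r : ι → ℝ) : Prop :=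
  Antitone (fun a => r (π a)) ∧
    ∀ r' : ι → ℝ, Antitone (fun a => r' (π a)) →
      ∑ i, (y i - r i) ^ 2 ≤ ∑ i, (y i - r' i) ^ 2

/-- The isotonic regression problem has exactly one solution. -/
theorem existsUnique_isIsotonicFit {ι : Type*} [Fintype ι] {k : ℕ} (π : Fin k ≃ ι)
    (y : ι → ℝ) : ∃! r : ι → ℝ, IsIsotonicFit π y r := by
  classical
  let K : Set (EuclideanSpace ℝ ι) := {v | Antitone (fun a => v (π a))}
  have hK : K = ⋂ (a : Fin k) (b : Fin k) (_ : a ≤ b),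
      {v : EuclideanSpace ℝ ι | v (π b) ≤ v (π a)} := by
    ext v
    simp only [K, Set.mem_ofPred_eq, Set.mem_iInter]
    exact ⟨fun h a b hab => h hab, fun h a b hab => h a b hab⟩
  have hclosed : IsClosed K := by
    rw [hK]
    refine isClosed_iInter fun a => isClosed_iInter fun b => isClosed_iInter fun _ => ?_
    exact isClosed_le (by fun_prop) (by fun_prop)
  have hne : K.Nonempty := ⟨0, fun a b _ => by simp⟩
  have hconv : Convex ℝ K := by
    intro v hv w hw s t hs ht _ a b hab
    have h1 := mul_le_mul_of_nonneg_left (hv hab) hs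
    have h2 := mul_le_mul_of_nonneg_left (hw hab) ht
    simp only [PiLp.add_apply, PiLp.smul_apply, smul_eq_mul]
    linarith
  have hsq : ∀ r : ι → ℝ,
      ‖WithLp.toLp 2 y - WithLp.toLp 2 r‖ ^ 2 = ∑ i, (y i - r i) ^ 2 := by
    intro r
    rw [EuclideanSpace.norm_sq_eq]
    simp
  obtain ⟨v, hvK, hv⟩ := exists_norm_eq_iInf_of_complete_convex hne hclosed.isComplete hconv
    (WithLp.toLp 2 y)
  have hbdd : BddBelow (Set.range fun w : K => ‖WithLp.toLp 2 y - (w : EuclideanSpace ℝ ι)‖) :=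
    ⟨0, by rintro _ ⟨w, rfl⟩; exact norm_nonneg _⟩
  refine existsUnique_of_exists_of_unique ⟨fun i => v i, hvK, fun r' hr' => ?_⟩ ?_
  · rw [← hsq, ← hsq]
    have h := ciInf_le hbdd ⟨WithLp.toLp 2 r', hr'⟩
    rw [← hv] at h
    exact pow_le_pow_left₀ (norm_nonneg _) h 2
  · rintro r s ⟨hr, hr'⟩ ⟨hs, hs'⟩
    have hmid : Antitone (fun a => (fun i => (r i + s i) / 2) (π a)) := by
      intro a b hab
      have h1 := hr hab
      have h2 := hs hab
      simp only at h1 h2 ⊢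
      linarith
    have h1 := hr' (fun i => (r i + s i) / 2) hmid
    have h2 := hs' (fun i => (r i + s i) / 2) hmid
    have hid : ∑ i, (y i - (r i + s i) / 2) ^ 2 + ∑ i, (r i - s i) ^ 2 / 4
        = (∑ i, (y i - r i) ^ 2 + ∑ i, (y i - s i) ^ 2) / 2 := by
      rw [← Finset.sum_add_distrib, ← Finset.sum_add_distrib, Finset.sum_div]
      exact Finset.sum_congr rfl fun i _ => by ring
    have h0 : ∑ i, (r i - s i) ^ 2 / 4 ≤ 0 := by linarith
    have hz := (Finset.sum_eq_zero_iff_of_nonneg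
      (fun i _ => by positivity)).1 (le_antisymm h0 (Finset.sum_nonneg fun i _ => by positivity))
    funext i
    have := hz i (Finset.mem_univ i)
    have h3 : (r i - s i) ^ 2 = 0 := by linarith
    exact sub_eq_zero.1 (pow_eq_zero_iff (two_ne_zero) |>.1 h3)

/-- The rank-calibrated scores: the solution of the isotonic regression of `y` under `π`. -/
noncomputable def isotonicFit {ι : Type*} [Fintype ι] {k : ℕ} (π : Fin k ≃ ι)
    (y : ι → ℝ) : ι → ℝ :=
  (existsUnique_isIsotonicFit π y).choose

theorem isotonicFit_spec {ι : Type*} [Fintype ι] {k : ℕ} (π : Fin k ≃ ι) (y : ι → ℝ) :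
    IsIsotonicFit π y (isotonicFit π y) :=
  (existsUnique_isIsotonicFit π y).choose_spec.1

/-- Isotonic mechanism for completely overlapping ownership: item set `ι`, owner set `κ`,
credentials `α`, one reported ranking `π j` of all items per owner. The output is the
`α`-weighted average of the rank-calibrated scores. -/
noncomputable def completeMechanism {ι κ : Type*} [Fintype ι] [Fintype κ] {k : ℕ}
    (α : κ → ℝ) (π : κ → (Fin k ≃ ι)) (y : ι → ℝ) : ι → ℝ :=
  fun i => (∑ j, α j * isotonicFit (π j) y i) / ∑ j, α j

/-- The owners who own all items of the block `S`. -/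
def blockOwners {m n : ℕ} (I : Fin m → Finset (Fin n)) (S : Finset (Fin n)) : Finset (Fin m) :=
  {j | S ⊆ I j}

/-- The blocks of the partition `P` whose ranking is elicited from owner `j`: blocks with at least
two items, completely owned by `j`. -/
abbrev ElicitedBlock {m n : ℕ} (I : Fin m → Finset (Fin n))
    (P : Finpartition (Finset.univ : Finset (Fin n))) (j : Fin m) : Type :=
  {S : Finset (Fin n) // S ∈ P.parts ∧ 2 ≤ S.card ∧ j ∈ blockOwners I S}

/-- A report of owner `j`: a ranking (best item first) of the items of each block that is
elicited from `j`. -/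
abbrev Report {m n : ℕ} (I : Fin m → Finset (Fin n))
    (P : Finpartition (Finset.univ : Finset (Fin n))) (j : Fin m) : Type :=
  (S : ElicitedBlock I P j) → (Fin S.1.card ≃ S.1)

/-- The partition-based isotonic mechanism. On each block with at least two items and at least one
complete owner, it runs the mechanism for completely overlapping ownership with the complete owners
of the block; on every other block it elicits nothing and returns the raw scores. -/
noncomputable def partitionMechanism {m n : ℕ} (I : Fin m → Finset (Fin n))
    (P : Finpartition (Finset.univ : Finset (Fin n))) (α : Fin m → ℝ)
    (r : (j : Fin m) → Report I P j) (y : Fin n → ℝ) : Fin n → ℝ :=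
  fun i =>
    if h : 2 ≤ (P.part i).card ∧ (blockOwners I (P.part i)).Nonempty then
      completeMechanism (k := (P.part i).card)
        (fun j : blockOwners I (P.part i) => α j)
        (fun j : blockOwners I (P.part i) =>
          r j ⟨P.part i, P.part_mem.2 (Finset.mem_univ i), h.1, j.2⟩)
        (fun i' : P.part i => y i')
        ⟨i, P.mem_part (Finset.mem_univ i)⟩
    else y i

/-- Bayes-Nash equilibrium: for no player does a unilateral deviation from `r` increase the
expected utility, the expectation being over the random raw scores `y`. Here `M` is the map from
reports and raw scores to adjusted scores and `u j` the utility of player `j` of the adjusted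
scores. -/
def IsBayesNashEquilibrium {m n : ℕ} {A : Fin m → Type*} {Ω : Type*} [MeasurableSpace Ω]
    (M : ((j : Fin m) → A j) → (Fin n → ℝ) → (Fin n → ℝ))
    (u : Fin m → (Fin n → ℝ) → ℝ) (μ : Measure Ω) (y : Ω → Fin n → ℝ)
    (r : (j : Fin m) → A j) : Prop :=
  ∀ (j : Fin m) (d : A j),
    ∫ ω, u j (M (Function.update r j d) (y ω)) ∂μ ≤ ∫ ω, u j (M r (y ω)) ∂μ

/-- The random vector `z` is exchangeable. -/
def IsExchangeable {n : ℕ} {Ω : Type*} [MeasurableSpace Ω] (μ : Measure Ω)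
    (z : Ω → Fin n → ℝ) : Prop :=
  ∀ ρ : Equiv.Perm (Fin n), μ.map (fun ω i => z ω (ρ i)) = μ.map z

/-- Owner `j`'s utility of adjusted scores `x`, with per-item utility function `U j`. -/
def ownerUtility {m n : ℕ} (I : Fin m → Finset (Fin n)) (U : Fin m → ℝ → ℝ) (j : Fin m)
    (x : Fin n → ℝ) : ℝ :=
  ∑ i ∈ I j, U j (x i)

/-- `π` is a true ranking of the items of `S`: it lists them by descending ground-truth score. -/
def IsTrueRanking {n : ℕ} (R : Fin n → ℝ) {S : Finset (Fin n)} (π : Fin S.card ≃ S) : Prop :=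
  Antitone (fun a => R (π a))

/-- All owners report the true ranking of each of their elicited blocks. If ground-truth scores tie
inside a block, the true ranking is one fixed ranking of the block, the same for all of its
owners; without ties the second clause follows from the first. -/
def IsTruthfulProfile {m n : ℕ} (I : Fin m → Finset (Fin n))
    (P : Finpartition (Finset.univ : Finset (Fin n))) (R : Fin n → ℝ)
    (r : (j : Fin m) → Report I P j) : Prop :=
  (∀ (j : Fin m) (S : ElicitedBlock I P j), IsTrueRanking R (r j S)) ∧
    ∀ (j j' : Fin m) (S : Finset (Fin n))
      (hj : S ∈ P.parts ∧ 2 ≤ S.card ∧ j ∈ blockOwners I S)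
      (hj' : S ∈ P.parts ∧ 2 ≤ S.card ∧ j' ∈ blockOwners I S),
      r j ⟨S, hj⟩ = r j' ⟨S, hj'⟩

/-! An owner's deviation changes only its elicited blocks, and there the output moves from the fit
under the true ranking `p` to a convex combination giving weight `w` to the fit under the deviating
ranking `q`. By convexity the gain is at most `w` times that of a full switch.

The full switch is bounded pointwise by a coupling (`sum_isotonicFit_le_of_antitone`): the utility
under `q` with noise `z` is at most the utility `G` under `p` with the noise permuted so that each
rank position keeps its noise. This combines a subgradient inequality, the projection properties of
isotonic regression and the rearrangement inequality.

So the gain is at most `w * (G (e z) - G z)`, where the permutation `e` preserves the law of `z` by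
exchangeability. Summing over the finite orbit of `e` telescopes the bound to zero, so the expected
gain is nonpositive even if `G` is not integrable. -/

section Isotonic

/-! ### Isotonic regression as projection onto a convex cone -/

variable {ι : Type*} [Fintype ι] {k : ℕ} {π : Fin k ≃ ι} {y r : ι → ℝ}

theorem IsIsotonicFit.sum_mul_sub_nonpos (h : IsIsotonicFit π y r) {r' : ι → ℝ}
    (hr' : Antitone fun a => r' (π a)) : ∑ i, (y i - r i) * (r' i - r i) ≤ 0 := by
  by_contra! hV
  set V := ∑ i, (y i - r i) * (r' i - r i) with hVdef
  set Q := ∑ i, (r' i - r i) ^ 2 with hQdef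
  have hQ : 0 ≤ Q := Finset.sum_nonneg fun i _ => sq_nonneg _
  -- Moving by `t` towards `r'` changes the objective by `t * (t * Q - 2 * V)`. This `t` lies in
  -- `(0, 1]` and makes it negative, also when `Q = 0`.
  set t := V / (V + Q) with ht
  have ht0 : 0 < t := by positivity
  have ht1 : t ≤ 1 := div_le_one_of_le₀ (by linarith) (by linarith)
  have htV : t * (V + Q) = V := div_mul_cancel₀ _ (by positivity)
  have hanti : Antitone fun a => (fun i => r i + t * (r' i - r i)) (π a) := by
    intro a b hab
    have h1 := mul_le_mul_of_nonneg_left (h.1 hab) (sub_nonneg.2 ht1)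
    have h2 := mul_le_mul_of_nonneg_left (hr' hab) ht0.le
    simp only at h1 h2 ⊢
    linarith
  have hmin := h.2 (fun i => r i + t * (r' i - r i)) hanti
  have hexp : ∑ i, (y i - (r i + t * (r' i - r i))) ^ 2
      = ∑ i, (y i - r i) ^ 2 - 2 * t * V + t ^ 2 * Q := by
    rw [hVdef, hQdef, Finset.mul_sum, Finset.mul_sum, ← Finset.sum_sub_distrib,
      ← Finset.sum_add_distrib]
    exact Finset.sum_congr rfl fun i _ => by ring
  rw [hexp] at hmin
  nlinarith [mul_pos ht0 hV, mul_pos (mul_pos ht0 ht0) hV]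

theorem IsIsotonicFit.sum_mul_nonpos (h : IsIsotonicFit π y r) {c : ι → ℝ}
    (hc : Antitone fun a => c (π a)) : ∑ i, (y i - r i) * c i ≤ 0 := by
  simpa using h.sum_mul_sub_nonpos (r' := fun i => r i + c i) (h.1.add hc)

/-- The residuals of an isotonic fit are orthogonal to every monotone function of the fit. -/
theorem IsIsotonicFit.sum_mul_comp_eq_zero (h : IsIsotonicFit π y r) {φ : ℝ → ℝ}
    (hφ : Monotone φ) : ∑ i, (y i - r i) * φ (r i) = 0 := by
  refine le_antisymm (h.sum_mul_nonpos (hφ.comp_antitone h.1)) ?_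
  -- For small `t > 0` the vector `r - t * φ(r)` is still feasible: ties of `r` stay ties because
  -- `φ` sees only the value, and strict inequalities survive small perturbations.
  have hev : ∀ᶠ t : ℝ in nhdsWithin 0 (Set.Ioi 0),
      ∀ a b : Fin k, a ≤ b → r (π b) - t * φ (r (π b)) ≤ r (π a) - t * φ (r (π a)) := by
    refine Filter.eventually_all.2 fun a => Filter.eventually_all.2 fun b => ?_
    by_cases hab : a ≤ b
    · rcases (h.1 hab).eq_or_lt with heq | hlt
      · simp only at heq
        simp [heq]
      · have h1 : Filter.Tendsto (fun t : ℝ => r (π b) - t * φ (r (π b))) (nhds 0)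
            (nhds (r (π b) - 0 * φ (r (π b)))) := Continuous.tendsto (by fun_prop) 0
        have h2 : Filter.Tendsto (fun t : ℝ => r (π a) - t * φ (r (π a))) (nhds 0)
            (nhds (r (π a) - 0 * φ (r (π a)))) := Continuous.tendsto (by fun_prop) 0
        have := h1.eventually_lt h2 (by simpa using hlt)
        exact (this.filter_mono nhdsWithin_le_nhds).mono fun t ht _ => ht.le
    · simp [hab]
  obtain ⟨t, ht, ht0⟩ := (hev.and self_mem_nhdsWithin).exists
  have ht0 : 0 < t := ht0
  have h1 := h.sum_mul_sub_nonpos (r' := fun i => r i - t * φ (r i)) fun a b hab => ht a b hab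
  have h2 : ∑ i, (y i - r i) * (r i - t * φ (r i) - r i)
      = -(t * ∑ i, (y i - r i) * φ (r i)) := by
    rw [Finset.mul_sum, ← Finset.sum_neg_distrib]
    exact Finset.sum_congr rfl fun i _ => by ring
  rw [h2] at h1
  exact nonneg_of_mul_nonneg_right (by linarith) ht0

/-- Projection onto a convex set is nonexpansive: add the variational inequalities of the two fits.
This yields continuity, hence measurability in the noise. -/
theorem sum_sq_isotonicFit_sub_le (π : Fin k ≃ ι) (y y' : ι → ℝ) :
    ∑ i, (isotonicFit π y i - isotonicFit π y' i) ^ 2 ≤ ∑ i, (y i - y' i) ^ 2 := by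
  have h := isotonicFit_spec π y
  have h' := isotonicFit_spec π y'
  have h1 := h.sum_mul_sub_nonpos h'.1
  have h2 := h'.sum_mul_sub_nonpos h.1
  have h3 : ∑ i, (isotonicFit π y i - isotonicFit π y' i) ^ 2 - ∑ i, (y i - y' i) ^ 2
      ≤ 2 * (∑ i, (y i - isotonicFit π y i) * (isotonicFit π y' i - isotonicFit π y i)
        + ∑ i, (y' i - isotonicFit π y' i) * (isotonicFit π y i - isotonicFit π y' i)) := by
    rw [← Finset.sum_add_distrib, ← Finset.sum_sub_distrib, Finset.mul_sum]
    refine Finset.sum_le_sum fun i _ => ?_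
    nlinarith [sq_nonneg ((y i - y' i) - (isotonicFit π y i - isotonicFit π y' i))]
  linarith

theorem continuous_isotonicFit (π : Fin k ≃ ι) : Continuous (isotonicFit π) := by
  refine continuous_pi fun i => continuous_iff_continuousAt.2 fun y => ?_
  refine tendsto_iff_dist_tendsto_zero.2 ?_
  have hlim : Filter.Tendsto (fun y' : ι → ℝ => √(∑ i, (y' i - y i) ^ 2)) (nhds y) (nhds 0) := by
    have : Continuous fun y' : ι → ℝ => √(∑ i, (y' i - y i) ^ 2) := by fun_prop
    simpa using this.tendsto y
  refine squeeze_zero (fun _ => dist_nonneg) (fun y' => ?_) hlim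
  rw [Real.dist_eq]
  refine Real.abs_le_sqrt (le_trans ?_ (sum_sq_isotonicFit_sub_le π y' y))
  exact Finset.single_le_sum
    (f := fun i => (isotonicFit π y' i - isotonicFit π y i) ^ 2)
    (fun i _ => sq_nonneg _) (Finset.mem_univ i)

end Isotonic

/-! ### Pointwise coupling of two rankings -/

theorem ConvexOn.exists_monotone_subgradient {f : ℝ → ℝ} (hf : ConvexOn ℝ Set.univ f) :
    ∃ φ : ℝ → ℝ, Monotone φ ∧ ∀ x y, f x + φ x * (y - x) ≤ f y := by
  refine ⟨fun x => derivWithin f (Set.Ioi x) x, ?_, fun x y => ?_⟩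
  · have := hf.monotoneOn_rightDeriv
    rwa [interior_univ, monotoneOn_univ] at this
  · have hx : x ∈ interior (Set.univ : Set ℝ) := by simp
    rcases lt_trichotomy x y with h | rfl | h
    · have h1 := hf.rightDeriv_le_slope_of_mem_interior hx (Set.mem_univ y) h
      rw [slope_def_field, le_div_iff₀ (sub_pos.2 h)] at h1
      linarith
    · simp
    · have h1 := hf.slope_le_leftDeriv_of_mem_interior (Set.mem_univ y) hx h
      have h2 := h1.trans (hf.leftDeriv_le_rightDeriv_of_mem_interior hx)
      rw [slope_def_field, div_le_iff₀ (sub_pos.2 h)] at h2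
      linarith

/-- Fitting under a true ranking `π'` yields at least the utility of fitting under any ranking `π`,
when the noise is transported by the permutation that takes `π'` to `π`. -/
theorem sum_isotonicFit_le_of_antitone {ι : Type*} [Fintype ι] {k : ℕ} {π π' : Fin k ≃ ι}
    {R : ι → ℝ} (hR : Antitone fun a => R (π' a)) {f : ℝ → ℝ} (hf : ConvexOn ℝ Set.univ f)
    (z : ι → ℝ) :
    ∑ i, f (isotonicFit π (fun i => R i + z i) i)
      ≤ ∑ i, f (isotonicFit π' (fun i => R i + z ((π'.symm.trans π) i)) i) := by
  obtain ⟨φ, hφ, hsub⟩ := hf.exists_monotone_subgradient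
  set B := isotonicFit π (fun i => R i + z i) with hB
  set A := isotonicFit π' (fun i => R i + z ((π'.symm.trans π) i)) with hA
  have hBs : IsIsotonicFit π (fun i => R i + z i) B := isotonicFit_spec _ _
  have hAs : IsIsotonicFit π' (fun i => R i + z ((π'.symm.trans π) i)) A := isotonicFit_spec _ _
  -- Items are matched by rank position `a`; both fits then carry the same noise `z (π a)`, which
  -- cancels in `h5`.
  rw [← Equiv.sum_comp π, ← Equiv.sum_comp π']
  -- Monotonicity of the subgradient makes `φ(B)` descend along positions, so it can be tested
  -- against the residuals of `A` in `h1` and used in the rearrangement inequality `h3`.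
  have hg : Antitone fun a => φ (B (π a)) := hφ.comp_antitone hBs.1
  have h1 : ∑ a, (R (π' a) + z (π a) - A (π' a)) * φ (B (π a)) ≤ 0 := by
    have := hAs.sum_mul_nonpos (c := fun i => φ (B (π (π'.symm i)))) (by simpa using hg)
    rw [← Equiv.sum_comp π'] at this
    simpa using this
  have h2 : ∑ a, (R (π a) + z (π a) - B (π a)) * φ (B (π a)) = 0 := by
    rw [← hBs.sum_mul_comp_eq_zero hφ, ← Equiv.sum_comp π]
  have h3 : ∑ a, φ (B (π a)) * R (π a) ≤ ∑ a, φ (B (π a)) * R (π' a) := by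
    have := (hg.monovary hR).sum_mul_comp_perm_le_sum_mul (σ := π.trans π'.symm)
    simpa using this
  have h4 : ∑ a, (f (B (π a)) + φ (B (π a)) * (A (π' a) - B (π a))) ≤ ∑ a, f (A (π' a)) :=
    Finset.sum_le_sum fun a _ => hsub _ _
  have h5 : ∑ a, φ (B (π a)) * (A (π' a) - B (π a))
      = ∑ a, φ (B (π a)) * R (π' a) - ∑ a, φ (B (π a)) * R (π a)
        - ∑ a, (R (π' a) + z (π a) - A (π' a)) * φ (B (π a))
        + ∑ a, (R (π a) + z (π a) - B (π a)) * φ (B (π a)) := by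
    simp only [← Finset.sum_sub_distrib, ← Finset.sum_add_distrib]
    exact Finset.sum_congr rfl fun a _ => by ring
  rw [Finset.sum_add_distrib] at h4
  linarith

/-- A function dominated by a multiple of a coboundary `G ∘ e - G` of a measure-preserving map of
finite order has non-positive integral; no integrability of `G` is needed. -/
theorem integral_nonpos_of_le_coboundary {X : Type*} [MeasurableSpace X] {ν : Measure X}
    {e : X → X} (he : MeasurePreserving e ν ν) {N : ℕ} (hN : 0 < N) (heN : e^[N] = id)
    {D G : X → ℝ} (hD : Integrable D ν) {w : ℝ} (hle : ∀ x, D x ≤ w * (G (e x) - G x)) :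
    ∫ x, D x ∂ν ≤ 0 := by
  have hpres : ∀ i, MeasurePreserving e^[i] ν ν := fun i => he.iterate i
  have hint : ∀ i, ∫ x, D (e^[i] x) ∂ν = ∫ x, D x ∂ν := by
    intro i
    have := integral_map (hpres i).measurable.aemeasurable (f := D)
      (by rw [(hpres i).map_eq]; exact hD.1)
    rw [(hpres i).map_eq] at this
    exact this.symm
  have hsum : ∫ x, ∑ i ∈ Finset.range N, D (e^[i] x) ∂ν = N * ∫ x, D x ∂ν := by
    rw [integral_finsetSum (f := fun i x => D (e^[i] x)) _
      fun i _ => (hpres i).integrable_comp_of_integrable hD]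
    simp [hint]
  -- The bound telescopes along the orbit, which closes up after `N` steps; `G` disappears before
  -- anything is integrated.
  have hle0 : ∀ x, ∑ i ∈ Finset.range N, D (e^[i] x) ≤ 0 := by
    intro x
    calc ∑ i ∈ Finset.range N, D (e^[i] x)
        ≤ ∑ i ∈ Finset.range N, w * (G (e^[i + 1] x) - G (e^[i] x)) :=
          Finset.sum_le_sum fun i _ => by
            rw [Function.iterate_succ_apply']; exact hle _
      _ = 0 := by
          rw [← Finset.mul_sum, Finset.sum_range_sub fun i => G (e^[i] x), heN]
          simp
  have h0 : N * ∫ x, D x ∂ν ≤ 0 := hsum ▸ integral_nonpos hle0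
  have hN' : (0 : ℝ) < N := by exact_mod_cast hN
  exact nonpos_of_mul_nonpos_right h0 hN'

theorem completeMechanism_update {ι κ : Type*} [Fintype ι] [Fintype κ] [DecidableEq κ] {k : ℕ}
    {α : κ → ℝ} (hα : ∑ j, α j ≠ 0) (p q : Fin k ≃ ι) (j : κ) (y : ι → ℝ) (i : ι) :
    completeMechanism α (Function.update (fun _ => p) j q) y i
      = (1 - α j / ∑ j, α j) * isotonicFit p y i + α j / (∑ j, α j) * isotonicFit q y i := by
  have h : ∑ j', α j' * isotonicFit (Function.update (fun _ => p) j q j') y i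
      = (∑ j', α j') * isotonicFit p y i
        + α j * (isotonicFit q y i - isotonicFit p y i) := by
    have h1 : ∀ j', α j' * isotonicFit (Function.update (fun _ => p) j q j') y i
        = α j' * isotonicFit p y i
          + if j' = j then α j * (isotonicFit q y i - isotonicFit p y i) else 0 := by
      intro j'
      by_cases hj : j' = j
      · subst hj
        simp only [Function.update_self, if_true]
        ring
      · simp [hj]
    simp only [h1, Finset.sum_add_distrib, Finset.sum_mul]
    simp
  unfold completeMechanism
  rw [h]
  field_simp
  ring

/-- The change of the utility `f` on the block `S` when a reporter of weight `w` switches from the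
ranking `p` to the ranking `q`, as a function of the noise `z`. -/
noncomputable def blockGain {n : ℕ} (f : ℝ → ℝ) (w : ℝ) (R : Fin n → ℝ) {S : Finset (Fin n)}
    {k : ℕ} (p q : Fin k ≃ S) (z : Fin n → ℝ) : ℝ :=
  ∑ i : S, (f ((1 - w) * isotonicFit p (fun i => R i + z i) i
      + w * isotonicFit q (fun i => R i + z i) i)
    - f (isotonicFit p (fun i => R i + z i) i))

/-! ### Expected gain on one block -/

section BlockGain

variable {n : ℕ} {f : ℝ → ℝ} {w : ℝ} {R : Fin n → ℝ} {S : Finset (Fin n)} {k : ℕ}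

theorem blockGain_self (p : Fin k ≃ S) (z : Fin n → ℝ) : blockGain f w R p p z = 0 := by
  refine Finset.sum_eq_zero fun i _ => sub_eq_zero.2 (congrArg f ?_)
  ring

theorem measurable_blockGain (hf : Measurable f) (p q : Fin k ≃ S) :
    Measurable (blockGain f w R p q) := by
  have h : ∀ (p : Fin k ≃ S) (i : S),
      Measurable fun z : Fin n → ℝ => isotonicFit p (fun i => R i + z i) i := fun p i =>
    ((continuous_apply i).comp ((continuous_isotonicFit p).comp (by fun_prop))).measurable
  exact Finset.measurable_fun_sum _ fun i _ =>
    (hf.comp (((h p i).const_mul _).add ((h q i).const_mul _))).sub (hf.comp (h p i))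

/-- Convexity, then the coupling. The permutation of the block is extended by the identity to all
items, since exchangeability concerns the whole noise vector. -/
theorem blockGain_le (hf : ConvexOn ℝ Set.univ f) (hw0 : 0 ≤ w) (hw1 : w ≤ 1) {p : Fin k ≃ S}
    (hp : Antitone fun a => R (p a)) (q : Fin k ≃ S) (z : Fin n → ℝ) :
    blockGain f w R p q z
      ≤ w * (∑ i : S, f (isotonicFit p
            (fun i => R i + z (Equiv.Perm.ofSubtype (p.symm.trans q) i)) i)
        - ∑ i : S, f (isotonicFit p (fun i => R i + z i) i)) := by
  have h1 := sum_isotonicFit_le_of_antitone (π := q) (R := fun i : S => R i) hp hf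
    (fun i : S => z i)
  calc blockGain f w R p q z
      ≤ ∑ i : S, w * (f (isotonicFit q (fun i => R i + z i) i)
          - f (isotonicFit p (fun i => R i + z i) i)) := by
        refine Finset.sum_le_sum fun i _ => ?_
        have := hf.2 (Set.mem_univ (isotonicFit p (fun i => R i + z i) i))
          (Set.mem_univ (isotonicFit q (fun i => R i + z i) i)) (sub_nonneg.2 hw1) hw0
          (by ring)
        simp only [smul_eq_mul] at this
        linarith
    _ ≤ _ := by
        rw [← Finset.mul_sum, Finset.sum_sub_distrib]
        refine mul_le_mul_of_nonneg_left (sub_le_sub_right ?_ _) hw0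
        simpa only [Equiv.Perm.ofSubtype_apply_coe] using h1

theorem integral_blockGain_nonpos {Ω : Type*} [MeasurableSpace Ω] {μ : Measure Ω}
    {z : Ω → Fin n → ℝ} (hz : AEMeasurable z μ) (hexch : IsExchangeable μ z)
    (hf : ConvexOn ℝ Set.univ f) (hfm : Measurable f) (hw0 : 0 ≤ w) (hw1 : w ≤ 1)
    {p : Fin k ≃ S} (hp : Antitone fun a => R (p a)) (q : Fin k ≃ S)
    (hint : Integrable (fun ω => blockGain f w R p q (z ω)) μ) :
    ∫ ω, blockGain f w R p q (z ω) ∂μ ≤ 0 := by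
  have hm := measurable_blockGain (w := w) (R := R) hfm p q
  rw [← integral_map hz hm.aestronglyMeasurable]
  set ρ := Equiv.Perm.ofSubtype (p.symm.trans q) with hρ
  have hem : Measurable fun (x : Fin n → ℝ) i => x (ρ i) := by fun_prop
  have hiter : ∀ N : ℕ, (fun (x : Fin n → ℝ) i => x (ρ i))^[N] = fun x i => x ((ρ ^ N) i) := by
    intro N
    induction N with
    | zero => rfl
    | succ N ih =>
      rw [Function.iterate_succ', ih, pow_succ]
      rfl
  refine integral_nonpos_of_le_coboundary (e := fun x i => x (ρ i)) ⟨hem, ?_⟩ (orderOf_pos ρ) ?_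
    ((integrable_map_measure hm.aestronglyMeasurable hz).2 hint)
    (G := fun x => ∑ i : S, f (isotonicFit p (fun i => R i + x i) i))
    (fun x => blockGain_le hf hw0 hw1 hp q x)
  · rw [AEMeasurable.map_map_of_aemeasurable hem.aemeasurable hz]
    exact hexch ρ
  · rw [hiter, pow_orderOf_eq_one]
    rfl

end BlockGain

/-! ### Decomposition of a deviation over blocks -/

section Mechanism

variable {m n : ℕ} {I : Fin m → Finset (Fin n)}
  {P : Finpartition (Finset.univ : Finset (Fin n))} {α : Fin m → ℝ}
  {r : (j : Fin m) → Report I P j}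

theorem partitionMechanism_update_of_elicited
    (hr : ∀ (j j' : Fin m) (S : Finset (Fin n))
      (hj : S ∈ P.parts ∧ 2 ≤ S.card ∧ j ∈ blockOwners I S)
      (hj' : S ∈ P.parts ∧ 2 ≤ S.card ∧ j' ∈ blockOwners I S),
      r j ⟨S, hj⟩ = r j' ⟨S, hj'⟩)
    (hα : ∀ S ∈ P.parts, 2 ≤ S.card → (blockOwners I S).Nonempty →
      0 < ∑ j ∈ blockOwners I S, α j)
    (j : Fin m) (d : Report I P j) (S : ElicitedBlock I P j) (y : Fin n → ℝ) (i : S.1) :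
    partitionMechanism I P α (Function.update r j d) y i
      = (1 - α j / ∑ j' ∈ blockOwners I S.1, α j') * isotonicFit (r j S) (fun i => y i) i
        + α j / (∑ j' ∈ blockOwners I S.1, α j') * isotonicFit (d S) (fun i => y i) i := by
  obtain ⟨S, hS⟩ := S
  obtain ⟨i, hi⟩ := i
  have hpart : P.part i = S := P.part_eq_of_mem hS.1 hi
  subst hpart
  unfold partitionMechanism
  rw [dif_pos ⟨hS.2.1, j, hS.2.2⟩]
  -- The common true ranking makes the profile on the block constant except at `j`.
  have hprof : (fun j' : blockOwners I (P.part i) =>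
      Function.update r j d j' ⟨P.part i, P.part_mem.2 (Finset.mem_univ i), hS.2.1, j'.2⟩)
      = Function.update (fun _ => r j ⟨P.part i, hS⟩) ⟨j, hS.2.2⟩ (d ⟨P.part i, hS⟩) := by
    funext j'
    obtain ⟨j', hj'⟩ := j'
    by_cases h : j' = j
    · subst h
      simp
    · rw [Function.update_of_ne h, Function.update_of_ne (by simpa using h)]
      exact hr _ _ _ _ _
  rw [hprof, completeMechanism_update]
  · simp only [Finset.sum_coe_sort (blockOwners I (P.part i)) α]
  · rw [Finset.sum_coe_sort (blockOwners I (P.part i)) α]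
    exact (hα _ hS.1 hS.2.1 ⟨j, hS.2.2⟩).ne'

theorem partitionMechanism_update_of_not_elicited (j : Fin m) (d : Report I P j)
    (y : Fin n → ℝ) (i : Fin n)
    (hi : ¬ (2 ≤ (P.part i).card ∧ j ∈ blockOwners I (P.part i))) :
    partitionMechanism I P α (Function.update r j d) y i = partitionMechanism I P α r y i := by
  unfold partitionMechanism
  split_ifs with h
  · congr 1
    funext j'
    have hne : (j' : Fin m) ≠ j := fun hj => hi ⟨h.1, hj ▸ j'.2⟩
    rw [Function.update_of_ne hne]
  · rfl

/-- Elicited blocks are disjoint and contained in `I j`; the remaining items of `I j`, including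
those in partly owned blocks, contribute zero. -/
theorem sum_elicitedBlock_eq (j : Fin m) (g : Fin n → ℝ)
    (hg : ∀ i, ¬ (2 ≤ (P.part i).card ∧ j ∈ blockOwners I (P.part i)) → g i = 0) :
    ∑ i ∈ I j, g i = ∑ S : ElicitedBlock I P j, ∑ i : S.1, g i := by
  have hS : ∀ S : ElicitedBlock I P j, ∑ i : S.1, g i = ∑ i ∈ I j, if i ∈ S.1 then g i else 0 := by
    intro S
    have hsub : S.1 ⊆ I j := by simpa [blockOwners] using S.2.2.2
    rw [Finset.sum_ite_mem, Finset.inter_eq_right.2 hsub, Finset.sum_coe_sort S.1 g]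
  simp only [hS]
  rw [Finset.sum_comm]
  refine Finset.sum_congr rfl fun i _ => ?_
  by_cases h : 2 ≤ (P.part i).card ∧ j ∈ blockOwners I (P.part i)
  · rw [Finset.sum_eq_single
      (⟨P.part i, P.part_mem.2 (Finset.mem_univ i), h⟩ : ElicitedBlock I P j)]
    · simp [P.mem_part (Finset.mem_univ i)]
    · intro S _ hne
      refine if_neg fun hi => hne (Subtype.ext ?_)
      exact (P.part_eq_of_mem S.2.1 hi).symm
    · simp
  · simp [hg i h]

theorem ownerUtility_update_sub
    (hr : ∀ (j j' : Fin m) (S : Finset (Fin n))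
      (hj : S ∈ P.parts ∧ 2 ≤ S.card ∧ j ∈ blockOwners I S)
      (hj' : S ∈ P.parts ∧ 2 ≤ S.card ∧ j' ∈ blockOwners I S),
      r j ⟨S, hj⟩ = r j' ⟨S, hj'⟩)
    (hα : ∀ S ∈ P.parts, 2 ≤ S.card → (blockOwners I S).Nonempty →
      0 < ∑ j ∈ blockOwners I S, α j)
    (U : Fin m → ℝ → ℝ) (j : Fin m) (d : Report I P j) (R z : Fin n → ℝ) :
    ownerUtility I U j (partitionMechanism I P α (Function.update r j d) fun i => R i + z i)
        - ownerUtility I U j (partitionMechanism I P α r fun i => R i + z i)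
      = ∑ S : ElicitedBlock I P j,
        blockGain (U j) (α j / ∑ j' ∈ blockOwners I S.1, α j') R (r j S) (d S) z := by
  unfold ownerUtility
  rw [← Finset.sum_sub_distrib, sum_elicitedBlock_eq (P := P)]
  · refine Finset.sum_congr rfl fun S _ => Finset.sum_congr rfl fun i _ => ?_
    rw [partitionMechanism_update_of_elicited hr hα j d S]
    -- Truthfulness is treated as the trivial deviation to `r j`, so the same block formula
    -- evaluates both outputs.
    conv_lhs => rw [← Function.update_eq_self j r]
    rw [partitionMechanism_update_of_elicited hr hα j (r j) S]
    congr 2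
    rw [Function.update_eq_self]
    ring
  · intro i hi
    rw [partitionMechanism_update_of_not_elicited j d _ i hi, sub_self]

end Mechanism

theorem corollary1 {m n : ℕ}
    -- ownership sets, ground-truth scores, item partition, owner credentials
    (I : Fin m → Finset (Fin n)) (R : Fin n → ℝ)
    (P : Finpartition (Finset.univ : Finset (Fin n)))
    (α : Fin m → ℝ) (hα : ∀ j, α j ∈ Set.Icc (0 : ℝ) 1)
    -- the weighted average is defined on every block on which rankings are elicited
    (hαpos : ∀ S ∈ P.parts, 2 ≤ S.card → (blockOwners I S).Nonempty →
      0 < ∑ j ∈ blockOwners I S, α j)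
    -- exchangeable review noise
    {Ω : Type*} [MeasurableSpace Ω] (μ : Measure Ω) [IsProbabilityMeasure μ]
    (z : Ω → Fin n → ℝ) (hz : AEMeasurable z μ) (hexch : IsExchangeable μ z)
    -- convex non-decreasing utilities
    (U : Fin m → ℝ → ℝ) (hmono : ∀ j, Monotone (U j))
    (hconv : ∀ j, ConvexOn ℝ Set.univ (U j))
    -- truthful reports
    (r : (j : Fin m) → Report I P j) (hr : IsTruthfulProfile I P R r)
    -- the expectations in the equilibrium condition exist
    (hint : ∀ (j : Fin m) (d : Report I P j),
      Integrable (fun ω => ownerUtility I U j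
        (partitionMechanism I P α (Function.update r j d) (fun i => R i + z ω i))) μ) :
    IsBayesNashEquilibrium (partitionMechanism I P α) (ownerUtility I U) μ
      (fun ω i => R i + z ω i) r := by
  intro j d
  obtain ⟨htrue, hsame⟩ := hr
  have hgain := ownerUtility_update_sub hsame hαpos U j (R := R)
  have hbase : Integrable (fun ω => ownerUtility I U j
      (partitionMechanism I P α r fun i => R i + z ω i)) μ := by
    simpa using hint j (r j)
  have hblock : ∀ S : ElicitedBlock I P j, Integrable (fun ω => blockGain (U j)
      (α j / ∑ j' ∈ blockOwners I S.1, α j') R (r j S) (d S) (z ω)) μ := by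
    intro S
    -- Integrability is assumed only for total utilities. Deviating on `S` alone isolates the gain
    -- of that block, as all other gains vanish.
    refine ((hint j (Function.update (r j) S (d S))).sub hbase).congr (ae_of_all _ fun ω => ?_)
    simp only [Pi.sub_apply]
    rw [hgain, Finset.sum_eq_single S]
    · rw [Function.update_self]
    · intro S' _ hne
      rw [Function.update_of_ne hne, blockGain_self]
    · simp
  rw [← sub_nonpos, ← integral_sub (hint j d) hbase]
  simp only [hgain]
  rw [integral_finsetSum _ fun S _ => hblock S]
  refine Finset.sum_nonpos fun S _ => ?_
  have hpos := hαpos S.1 S.2.1 S.2.2.1 ⟨j, S.2.2.2⟩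
  refine integral_blockGain_nonpos hz hexch (hconv j) (hmono j).measurable
    (div_nonneg (hα j).1 hpos.le) ((div_le_one hpos).2 ?_) (htrue j S) (d S) (hblock S)
  exact Finset.single_le_sum (fun j' _ => (hα j').1) S.2.2.2
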